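/- Let $K\ge 1$ nodes be given. Node $k$ has a signal $y_k$ with $M_k$ channels and constant matrices $B_k\in\mathbb R^{M_k\times D}$, $\Gamma_k\in\mathbb R^{M_k\times L_k}$. For $X=[X_1^T,\dots,X_K^T]^T\in\mathbb R^{M\times Q}$, $M=\sum_k M_k$, with blocks $X_k\in\mathbb R^{M_k\times Q}$, and for given functions $f,g$ and sets $\mathcal X_k$, put $$p(X)=f\Big(\sum_k X_k^Ty_k,\ \sum_k X_k^TB_k\Big),\qquad q(X)=g\big([X_1^T\Gamma_1,\dots,X_K^T\Gamma_K]\big),$$ $$\mathcal D_k=\{X_k : [X_k^Ty_k,\,X_k^TB_k]\in\mathcal X_k\},\qquad \mathcal D=\mathcal D_1\times\cdots\times\mathcal D_K,$$ and consider the global problem of minimizing $p(X)+q(X)$ over $X\in\mathcal D$. Assume that $p:\mathbb R^{M\times Q}\to\mathbb R$ is continuously differentiable with compact sublevel sets, that $q:\mathbb R^{M\times Q}\to\mathbb R$ is convex and block separable, i.e. $q(X)=\sum_k g_k(X_k^T\Gamma_k)$ for some functions $g_k$, and that $\mathcal D$ is closed. The NS-DASF algorithm (fully connected network, stationary signals)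 generates iterates $X^0,X^1,\dots$ as follows. At iteration $i=0,1,\dots$ the updating node $u$ is chosen in round-robin order $1,2,\dots,K,1,2,\dots$. The local problem at node $u$ is the problem of the same form (same $f,g,\mathcal X_k$), in the variable $\bar X$ with blocks $X_u\in\mathbb R^{M_u\times Q}$ and $G_k\in\mathbb R^{Q\times Q}$ $(k\ne u)$, in which $y_k,B_k,\Gamma_k$ are replaced by $(X_k^i)^Ty_k$, $(X_k^i)^TB_k$, $(X_k^i)^T\Gamma_k$ for every $k\neq u$. Let $\bar X^\star$ be a global solution of it, chosen, if there are several, at the smallest Frobenius distance to the point with block $u$ equal to $X^{i-1}_u$ and all other blocks equal to $I$ (with $X^{-1}:=X^0$). Then $X_u^{i+1}=X_u^\star$ and $X_k^{i+1}=X_k^iG_k^\star$ for $k\neq u$. A point $X^*$ is a fixed point of the algorithm if the algorithm can be run from $X^0=X^*$ and $X^0=X^*$ implies $X^i=X^*$ for all $i$. For a set $C$, let $N_C(x)$ denote the (general, i.e. limiting) normal cone of $C$ at $x\in C$: the set of limits of sequences $v_n$ such that, for some $x_n\to x$ in $C$, $\langle v_n,z-x_n\rangle\le o(\|z-x_n\|)$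 as $z\to x_n$ in $C$, for each $n$. Let $N_k(X^*)$ be the normal cone at $X^*$ of the subspace constraints of node $k$, i.e. of the set of all $Z\in\mathbb R^{M\times Q}$ such that, for every $j\ne k$, the columns of $Z_j$ lie in the column space of $X_j^*$ (the block $Z_k$ is free). Let $X^*$ be a fixed point of the NS-DASF algorithm, and assume the constraint qualifications $$N_{\mathcal D}(X^*)\cap N_k(X^*)=\{0\}\qquad\text{for every node } k.$$ Then $X^*$ is a stationary point of the global problem: $X^*\in\mathcal D$ and $$0\in\nabla p(X^*)+\partial q(X^*)+N_{\mathcal D}(X^*),$$ where $\partial q$ is the set of subgradients of the convex function $q$ and the sum of sets is a Minkowski sum. -/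

import Mathlib

open scoped Pointwise

noncomputable section

/-! ### Variational analysis in a real inner product space -/

section VariationalAnalysis

variable {E : Type*} [NormedAddCommGroup E] [InnerProductSpace ℝ E]

/-- The regular normal cone of `C` at `x`: the vectors `v` such that
`⟪v, z - x⟫ ≤ o(‖z - x‖)` as `z → x` in `C`. It is only used at points of `C`. -/
def regularNormalCone (C : Set E) (x : E) : Set E :=
  {v | ∀ ε : ℝ, 0 < ε →
    ∀ᶠ z in nhdsWithin x C, inner ℝ v (z - x) ≤ ε * ‖z - x‖}

/-- The (general, or limiting) normal cone of `C` at `x`: limits of regular normals at points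
of `C` converging to `x`. It is empty when `x ∉ C`. -/
def normalCone (C : Set E) (x : E) : Set E :=
  {v | x ∈ C ∧ ∃ (z : ℕ → E) (w : ℕ → E),
    (∀ n, z n ∈ C) ∧ (∀ n, w n ∈ regularNormalCone C (z n)) ∧
    Filter.Tendsto z Filter.atTop (nhds x) ∧ Filter.Tendsto w Filter.atTop (nhds v)}

/-- The set of subgradients at `x` of a (convex) function `h`. -/
def subdifferential (h : E → ℝ) (x : E) : Set E :=
  {v | ∀ z, h x + inner ℝ v (z - x) ≤ h z}

end VariationalAnalysis

namespace NSDASF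

/-! ### Block matrices -/

/-- The space of real matrices with `Q` columns whose rows are partitioned into `K` blocks, the
rows of block `k` being indexed by `ρ k`. Its norm is the Frobenius norm. With
`ρ k = Fin (M k)` it is the space of `M × Q` matrices, `M = ∑ k, M k`. -/
abbrev BlockSpace {K : ℕ} (ρ : Fin K → Type) (Q : ℕ) : Type :=
  PiLp 2 (fun k : Fin K => EuclideanSpace ℝ (ρ k × Fin Q))

/-- A matrix as a vector of the Euclidean space of its entries. -/
def vec {m : Type} {Q : ℕ} (A : Matrix m (Fin Q) ℝ) : EuclideanSpace ℝ (m × Fin Q) :=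
  WithLp.toLp 2 (fun s => A s.1 s.2)

/-- The inverse of `vec`. -/
def mat {m : Type} {Q : ℕ} (v : EuclideanSpace ℝ (m × Fin Q)) : Matrix m (Fin Q) ℝ :=
  Matrix.of (fun i j => v (i, j))

/-- The block matrix with blocks `A k`. -/
def stack {K : ℕ} {ρ : Fin K → Type} {Q : ℕ} (A : ∀ k, Matrix (ρ k) (Fin Q) ℝ) :
    BlockSpace ρ Q :=
  WithLp.toLp 2 (fun k => vec (A k))

/-- The block `X k` of a block matrix. -/
def blk {K : ℕ} {ρ : Fin K → Type} {Q : ℕ} (X : BlockSpace ρ Q) (k : Fin K) :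
    Matrix (ρ k) (Fin Q) ℝ :=
  mat (X k)

/-! ### The filtering problem -/

/-- The functions and sets that define a problem, for filters with `Q` output channels.
A `Q`-channel signal is a matrix with `Q` rows and one column for each element of `T`, where `T`
is an arbitrary type. For a random signal `T` is the sample space and `f` a functional of random
vectors; for a matrix of samples `T` is the set of sample times. -/
structure Spec (K Q D : ℕ) (L : Fin K → ℕ) (T : Type*) where
  /-- The smooth term, a function of `Xᵀ y` and `Xᵀ B`. -/
  f : Matrix (Fin Q) T ℝ → Matrix (Fin Q) (Fin D) ℝ → ℝ
  /-- The nonsmooth term, a function of the matrix `Xᵀ Γ` with `∑ k, L k` columns. -/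
  g : Matrix (Fin Q) (Σ k : Fin K, Fin (L k)) ℝ → ℝ
  /-- The constraint sets, to which the pairs `[X kᵀ y k, X kᵀ B k]` have to belong. -/
  constr : Fin K → Set (Matrix (Fin Q) T ℝ × Matrix (Fin Q) (Fin D) ℝ)

/-- The data of a problem: the signals `y k` of the nodes and their deterministic matrices. -/
structure Data {K : ℕ} (D : ℕ) (L : Fin K → ℕ) (T : Type*) (ρ : Fin K → Type) where
  y : ∀ k, Matrix (ρ k) T ℝ
  B : ∀ k, Matrix (ρ k) (Fin D) ℝ
  Γ : ∀ k, Matrix (ρ k) (Fin (L k)) ℝ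

section Problem

variable {K Q D : ℕ} {L : Fin K → ℕ} {T : Type*} {ρ : Fin K → Type} [∀ k, Fintype (ρ k)]

/-- `p X = f (Xᵀ y, Xᵀ B)`, where `Xᵀ y = ∑ k, X kᵀ y k` and `Xᵀ B = ∑ k, X kᵀ B k`. -/
def smoothPart (S : Spec K Q D L T) (d : Data D L T ρ) (X : BlockSpace ρ Q) : ℝ :=
  S.f (∑ k, (blk X k).transpose * d.y k) (∑ k, (blk X k).transpose * d.B k)

/-- `q X = g (Xᵀ Γ)`. As `Γ` is block diagonal, `Xᵀ Γ = [X 1ᵀ Γ 1, …, X Kᵀ Γ K]`. -/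
def nonsmoothPart (S : Spec K Q D L T) (d : Data D L T ρ) (X : BlockSpace ρ Q) : ℝ :=
  S.g (Matrix.of (fun a s => ((blk X s.1).transpose * d.Γ s.1) a s.2))

/-- The feasible set: `[X kᵀ y k, X kᵀ B k]` lies in the `k`-th constraint set for every `k`. -/
def feasibleSet (S : Spec K Q D L T) (d : Data D L T ρ) : Set (BlockSpace ρ Q) :=
  {X | ∀ k, ((blk X k).transpose * d.y k, (blk X k).transpose * d.B k) ∈ S.constr k}

/-- The set of global minimizers of `p + q` over the feasible set. -/
def solutionSet (S : Spec K Q D L T) (d : Data D L T ρ) : Set (BlockSpace ρ Q) :=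
  {X | X ∈ feasibleSet S d ∧ ∀ Z ∈ feasibleSet S d,
    smoothPart S d X + nonsmoothPart S d X ≤ smoothPart S d Z + nonsmoothPart S d Z}

end Problem

/-! ### The local problems and the algorithm -/

section Algorithm

variable {K Q D : ℕ} {L M : Fin K → ℕ} {T : Type*}

/-- Row indices of block `k` in the local problem at node `q`: the `M q` original rows if
`k = q`, and `Q` rows (those of `G k`) if `k ≠ q`. -/
abbrev LocalRow (M : Fin K → ℕ) (Q : ℕ) (q k : Fin K) : Type :=
  {_i : Fin (M k) // k = q} ⊕ {_j : Fin Q // k ≠ q}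

/-- Compression at the current iterate `X`: a matrix `A` of node `k` is kept if `k = q`, and
replaced by `X kᵀ A` if `k ≠ q`. -/
def compress {n : Type*} (q : Fin K) (X : BlockSpace (fun k => Fin (M k)) Q) (k : Fin K)
    (A : Matrix (Fin (M k)) n ℝ) : Matrix (LocalRow M Q q k) n ℝ :=
  Matrix.of (Sum.elim (fun i => A i.1) (fun j => ((blk X k).transpose * A) j.1))

/-- The data of the local problem at node `q` when the current iterate is `X`. -/
def localData (d : Data D L T (fun k => Fin (M k))) (q : Fin K)
    (X : BlockSpace (fun k => Fin (M k)) Q) : Data D L T (LocalRow M Q q) where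
  y k := compress q X k (d.y k)
  B k := compress q X k (d.B k)
  Γ k := compress q X k (d.Γ k)

/-- The local variable with block `q` equal to `X q` and all other blocks `G k` equal to `I`. -/
def localPoint (q : Fin K) (X : BlockSpace (fun k => Fin (M k)) Q) :
    BlockSpace (LocalRow M Q q) Q :=
  stack (fun k => Matrix.of
    (Sum.elim (fun i => blk X k i.1) (fun j => (1 : Matrix (Fin Q) (Fin Q) ℝ) j.1)))

/-- The new estimate obtained from the local variable `Xbar`: its block `q` is the block `q` of
`Xbar`, and its block `k ≠ q` is `X k * G k`, where `G k` is the block `k` of `Xbar`. -/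
def expand (q : Fin K) (X : BlockSpace (fun k => Fin (M k)) Q)
    (Xbar : BlockSpace (LocalRow M Q q) Q) : BlockSpace (fun k => Fin (M k)) Q :=
  stack (fun k =>
    if h : k = q then Matrix.of (fun i => blk Xbar k (Sum.inl ⟨i, h⟩))
    else blk X k * Matrix.of (fun j => blk Xbar k (Sum.inr ⟨j, h⟩)))

/-- One iteration, with updating node `q`, current iterate `X` and previous iterate `Xprev`:
`Xnext` is obtained from a solution of the local problem which, among all the solutions, is
nearest in Frobenius norm to the point `[I, …, Xprev q, …, I]`. -/
def IsUpdate (S : Spec K Q D L T) (d : Data D L T (fun k => Fin (M k))) (q : Fin K)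
    (Xprev X Xnext : BlockSpace (fun k => Fin (M k)) Q) : Prop :=
  ∃ Xbar ∈ solutionSet S (localData d q X),
    (∀ Z ∈ solutionSet S (localData d q X),
      ‖Xbar - localPoint q Xprev‖ ≤ ‖Z - localPoint q Xprev‖) ∧
    Xnext = expand q X Xbar

/-- `X 0, X 1, …` is a sequence of iterates of the algorithm; the updating node of iteration `i`
is `i` modulo `K` (nodes are numbered from `0`). Iteration `0` has no previous iterate, and uses
`X 0` in its place. -/
def IsRun [NeZero K] (S : Spec K Q D L T) (d : Data D L T (fun k => Fin (M k)))
    (X : ℕ → BlockSpace (fun k => Fin (M k)) Q) : Prop :=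
  ∀ i : ℕ, IsUpdate S d (Fin.ofNat K i) (X (i - 1)) (X i) (X (i + 1))

/-- A fixed point: the algorithm can be run from `Xs`, and it then stays at `Xs`. -/
def IsFixedPoint [NeZero K] (S : Spec K Q D L T) (d : Data D L T (fun k => Fin (M k)))
    (Xs : BlockSpace (fun k => Fin (M k)) Q) : Prop :=
  (∃ X, IsRun S d X ∧ X 0 = Xs) ∧ ∀ X, IsRun S d X → X 0 = Xs → ∀ i, X i = Xs

/-- The subspace constraints of node `q` at `X`: for every `k ≠ q` the columns of block `k` lie
in the column space of `X k`; block `q` is free. -/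
def subspaceConstr (q : Fin K) (X : BlockSpace (fun k => Fin (M k)) Q) :
    Set (BlockSpace (fun k => Fin (M k)) Q) :=
  {Z | ∀ k, k ≠ q → ∀ j, (blk Z k).col j ∈ Submodule.span ℝ (Set.range (blk X k).col)}

end Algorithm

end NSDASF

end

/-! ### Regular normals and convex subgradients. -/

section NormalCones

variable {E : Type*} [NormedAddCommGroup E] [InnerProductSpace ℝ E]

/-! Write V_k for the subspace constraints of node k at the fixed point X. Since (X_k G_k)ᵀA =
G_kᵀ(X_kᵀA), the local problem at k is the global one restricted to the image of `expand`, which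
contains V_k. All K updates leave X unchanged, so X minimizes p + q over D ∩ V_k for every k.

First order conditions (`exists_optimality_of_isMin_inter_submodule`) then give ∇p(X) + s_k + v_k +
w_k = 0 with s_k ∈ ∂q(X), v_k ∈ N_D(X), w_k ⊥ V_k. Block k is free in V_k, so block k of w_k
vanishes. The multipliers depend on k, but D is a product and q is separable: taking block k from
s_k and from v_k yields again a subgradient (`toLp_diag_mem_subdifferential`) and a normal
(`toLp_diag_mem_normalCone`), and these satisfy the global condition.

The first order conditions come from a penalty argument. A separate variable z carries q, so the
z-condition gives a subgradient and the x-condition a regular normal. Subgradients stay bounded near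
X; if the multipliers of the subspace penalty blow up, their normalized limit contradicts the
constraint qualification. -/

theorem smul_mem_regularNormalCone {C : Set E} {x v : E} (hv : v ∈ regularNormalCone C x)
    {t : ℝ} (ht : 0 ≤ t) : t • v ∈ regularNormalCone C x := by
  intro ε hε
  -- Dividing by t + 1 rather than t also covers t = 0.
  have ht1 : 0 < t + 1 := by linarith
  filter_upwards [hv (ε / (t + 1)) (by positivity)] with z hz
  rw [real_inner_smul_left]
  have h1 := mul_le_mul_of_nonneg_left hz ht
  have h2 : t * (ε / (t + 1) * ‖z - x‖) = (t / (t + 1)) * (ε * ‖z - x‖) := by ring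
  have h3 : t / (t + 1) ≤ 1 := by rw [div_le_one ht1]; linarith
  have h4 : 0 ≤ ε * ‖z - x‖ := by positivity
  nlinarith

theorem orthogonal_subset_normalCone (V : Submodule ℝ E) {x w : E} (hx : x ∈ V) (hw : w ∈ Vᗮ) :
    w ∈ normalCone (V : Set E) x := by
  refine ⟨hx, fun _ => x, fun _ => w, fun _ => hx, fun _ ε hε => ?_, tendsto_const_nhds,
    tendsto_const_nhds⟩
  filter_upwards [self_mem_nhdsWithin] with z hz
  rw [Submodule.inner_left_of_mem_orthogonal (V.sub_mem hz hx) hw]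
  positivity

/-- Fermat's rule on a set, for a function that is bounded above near `x` by a differentiable
function plus a quadratic model. -/
theorem neg_mem_regularNormalCone_of_le [CompleteSpace E] {C : Set E} {p : E → ℝ} {x v u : E}
    {c : ℝ} (hp : HasGradientAt p v x)
    (h : ∀ᶠ y in nhdsWithin x C, p x ≤ p y + inner ℝ u (y - x) + c * ‖y - x‖ ^ 2) :
    -(v + u) ∈ regularNormalCone C x := by
  intro ε hε
  -- Half of ε pays for the linearization error, half for the quadratic term.
  have hlit := hp.hasFDerivAt.isLittleO.def (half_pos hε)
  have hnear : ∀ᶠ y in nhds x, |c| * ‖y - x‖ ≤ ε / 2 := by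
    have : Filter.Tendsto (fun y => |c| * ‖y - x‖) (nhds x) (nhds (|c| * ‖x - x‖)) :=
      Continuous.tendsto (by fun_prop) x
    rw [sub_self, norm_zero, mul_zero] at this
    exact (this.eventually_lt_const (half_pos hε)).mono fun _ => le_of_lt
  filter_upwards [h, nhdsWithin_le_nhds hlit, nhdsWithin_le_nhds hnear] with y h1 h2 h3
  rw [InnerProductSpace.toDual_apply_apply, Real.norm_eq_abs] at h2
  have h4 := (abs_le.1 h2).2
  have h5 : c * ‖y - x‖ ^ 2 ≤ ε / 2 * ‖y - x‖ := by
    have := mul_le_mul_of_nonneg_right (le_abs_self c) (sq_nonneg ‖y - x‖)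
    have := mul_le_mul_of_nonneg_right h3 (norm_nonneg (y - x))
    nlinarith
  rw [inner_neg_left, inner_add_left]
  linarith

/-- Compare z with z + t(y - z) for small t > 0: convexity bounds q there, and dividing by t and
letting t → 0 removes the quadratic term. Convexity is what turns local minimality into a global
inequality. -/
theorem mem_subdifferential_of_isLocalMin_add_sq {q : E → ℝ} (hq : ConvexOn ℝ Set.univ q)
    {x z : E} {c : ℝ}
    (h : ∀ᶠ y in nhds z, q z + c / 2 * ‖x - z‖ ^ 2 ≤ q y + c / 2 * ‖x - y‖ ^ 2) :
    c • (x - z) ∈ subdifferential q z := by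
  intro y
  have hpath : Filter.Tendsto (fun t : ℝ => z + t • (y - z)) (nhdsWithin 0 (Set.Ioi 0))
      (nhds z) := by
    have : Filter.Tendsto (fun t : ℝ => z + t • (y - z)) (nhds 0)
      (nhds (z + (0 : ℝ) • (y - z))) := Continuous.tendsto (by fun_prop) 0
    rw [zero_smul, add_zero] at this
    exact this.mono_left nhdsWithin_le_nhds
  have hlim : Filter.Tendsto
      (fun t : ℝ => q y - c * inner ℝ (x - z) (y - z) + t * (c / 2 * ‖y - z‖ ^ 2))
      (nhdsWithin 0 (Set.Ioi 0)) (nhds (q y - c * inner ℝ (x - z) (y - z))) := by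
    have : Filter.Tendsto
      (fun t : ℝ => q y - c * inner ℝ (x - z) (y - z) + t * (c / 2 * ‖y - z‖ ^ 2))
      (nhds 0) (nhds (q y - c * inner ℝ (x - z) (y - z) + 0 * (c / 2 * ‖y - z‖ ^ 2))) :=
      Continuous.tendsto (by fun_prop) 0
    rw [zero_mul, add_zero] at this
    exact this.mono_left nhdsWithin_le_nhds
  have key : q z ≤ q y - c * inner ℝ (x - z) (y - z) := by
    refine ge_of_tendsto hlim ?_
    have h1 : ∀ᶠ t : ℝ in nhdsWithin 0 (Set.Ioi 0), t < 1 :=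
      nhdsWithin_le_nhds (Iio_mem_nhds one_pos)
    filter_upwards [hpath.eventually h, self_mem_nhdsWithin, h1] with t ht h0 h1
    rw [Set.mem_Ioi] at h0
    have hconv := hq.2 (Set.mem_univ z) (Set.mem_univ y) (sub_nonneg.2 h1.le) h0.le (by ring)
    have e1 : (1 - t) • z + t • y = z + t • (y - z) := by module
    have e2 : ‖x - (z + t • (y - z))‖ ^ 2
        = ‖x - z‖ ^ 2 - 2 * (t * inner ℝ (x - z) (y - z)) + t ^ 2 * ‖y - z‖ ^ 2 := by
      rw [← sub_sub, norm_sub_sq_real, real_inner_smul_right, norm_smul, mul_pow,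
        Real.norm_eq_abs, sq_abs]
    rw [e1, smul_eq_mul, smul_eq_mul] at hconv
    rw [e2] at ht
    have : t * q z ≤
        t * (q y - c * inner ℝ (x - z) (y - z) + t * (c / 2 * ‖y - z‖ ^ 2)) := by
      nlinarith
    exact le_of_mul_le_mul_left this h0
  rw [real_inner_smul_left]
  linarith

theorem mem_subdifferential_of_tendsto {q : E → ℝ} (hq : Continuous q) {x s : E} {z v : ℕ → E}
    (hv : ∀ n, v n ∈ subdifferential q (z n)) (hz : Filter.Tendsto z Filter.atTop (nhds x))
    (hs : Filter.Tendsto v Filter.atTop (nhds s)) : s ∈ subdifferential q x := by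
  intro y
  exact le_of_tendsto (((hq.tendsto x).comp hz).add (hs.inner (tendsto_const_nhds.sub hz)))
    (Filter.Eventually.of_forall fun n => hv n y)

/-- A unit step along v raises q by at least ‖v‖, while |q| ≤ A on the ball of radius 2, which
contains the step. -/
theorem exists_norm_le_of_mem_subdifferential [ProperSpace E] {q : E → ℝ} (hq : Continuous q)
    (x : E) : ∃ R, ∀ z ∈ Metric.closedBall x 1, ∀ v ∈ subdifferential q z, ‖v‖ ≤ R := by
  obtain ⟨A, hA⟩ := (isCompact_closedBall x 2).exists_bound_of_continuousOn hq.continuousOn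
  refine ⟨2 * A, fun z hz v hv => ?_⟩
  rw [Metric.mem_closedBall, dist_eq_norm] at hz
  have hzA := hA z (by rw [Metric.mem_closedBall, dist_eq_norm]; linarith)
  rcases eq_or_ne v 0 with rfl | hv0
  · rw [norm_zero]; linarith [norm_nonneg (q z)]
  have hn : 0 < ‖v‖ := norm_pos_iff.2 hv0
  have hu : ‖(‖v‖)⁻¹ • v‖ = 1 := by
    rw [norm_smul, norm_inv, norm_norm, inv_mul_cancel₀ hn.ne']
  have hyA := hA (z + (‖v‖)⁻¹ • v) (by
    rw [Metric.mem_closedBall, dist_eq_norm, add_sub_right_comm]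
    linarith [norm_add_le (z - x) ((‖v‖)⁻¹ • v)])
  have h := hv (z + (‖v‖)⁻¹ • v)
  rw [add_sub_cancel_left, real_inner_smul_right, real_inner_self_eq_norm_sq, sq,
    inv_mul_cancel_left₀ hn.ne'] at h
  rw [Real.norm_eq_abs] at hzA hyA
  linarith [(abs_le.1 hzA).1, (abs_le.1 hyA).2]

end NormalCones

/-! ### Optimality conditions by penalization. -/

section ConstrainedMinimizer

variable {E : Type*} [NormedAddCommGroup E] [InnerProductSpace ℝ E] [FiniteDimensional ℝ E]

/-- Penalizing the constraint `x ∈ V` and doubling the variable of the second term: minimizers of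
the penalized problems converge to the constrained minimizer. -/
theorem exists_penalized_minimizers (V : Submodule ℝ E) {C : Set E} (hC : IsClosed C)
    {p q : E → ℝ} (hp : Continuous p) (hq : Continuous q) {a : E} (haC : a ∈ C) (haV : a ∈ V)
    (hmin : ∀ y ∈ C, y ∈ V → p a + q a ≤ p y + q y) :
    ∃ (c : ℕ → ℝ) (x z : ℕ → E), (∀ n, x n ∈ C) ∧
      Filter.Tendsto x Filter.atTop (nhds a) ∧ Filter.Tendsto z Filter.atTop (nhds a) ∧
      ∀ n, 0 < c n ∧ ∀ x' ∈ C ∩ Metric.closedBall a 1, ∀ z' ∈ Metric.closedBall a 1,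
        p (x n) + q (z n) + c n / 2 * ‖Vᗮ.starProjection (x n)‖ ^ 2 + c n / 2 * ‖x n - z n‖ ^ 2
            + 1 / 2 * ‖x n - a‖ ^ 2
          ≤ p x' + q z' + c n / 2 * ‖Vᗮ.starProjection x'‖ ^ 2 + c n / 2 * ‖x' - z'‖ ^ 2
            + 1 / 2 * ‖x' - a‖ ^ 2 := by
  have haB : a ∈ Metric.closedBall a 1 := Metric.mem_closedBall_self zero_le_one
  have hPa : Vᗮ.starProjection a = 0 := by
    rw [Submodule.starProjection_apply_eq_zero_iff, Submodule.orthogonal_orthogonal]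
    exact haV
  have hK : IsCompact ((C ∩ Metric.closedBall a 1) ×ˢ Metric.closedBall a 1) :=
    ((isCompact_closedBall a 1).inter_left hC).prod (isCompact_closedBall a 1)
  have hex : ∀ n : ℕ, ∃ w ∈ (C ∩ Metric.closedBall a 1) ×ˢ Metric.closedBall a 1,
      IsMinOn (fun w : E × E => p w.1 + q w.2 + ((n : ℝ) + 1) / 2 * ‖Vᗮ.starProjection w.1‖ ^ 2
        + ((n : ℝ) + 1) / 2 * ‖w.1 - w.2‖ ^ 2 + 1 / 2 * ‖w.1 - a‖ ^ 2)
        ((C ∩ Metric.closedBall a 1) ×ˢ Metric.closedBall a 1) w := fun n =>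
    hK.exists_isMinOn ⟨(a, a), ⟨haC, haB⟩, haB⟩ (by fun_prop)
  choose w hwK hw using hex
  obtain ⟨⟨b, b'⟩, hb, φ, hφ, hlim⟩ := hK.tendsto_subseq hwK
  have hx : Filter.Tendsto (fun n => (w (φ n)).1) Filter.atTop (nhds b) :=
    (continuous_fst.tendsto _).comp hlim
  have hz : Filter.Tendsto (fun n => (w (φ n)).2) Filter.atTop (nhds b') :=
    (continuous_snd.tendsto _).comp hlim
  have hle : ∀ n, p (w n).1 + q (w n).2
      + ((n : ℝ) + 1) / 2 * (‖Vᗮ.starProjection (w n).1‖ ^ 2 + ‖(w n).1 - (w n).2‖ ^ 2)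
      + 1 / 2 * ‖(w n).1 - a‖ ^ 2 ≤ p a + q a := fun n => by
    have := isMinOn_iff.1 (hw n) (a, a) ⟨⟨haC, haB⟩, haB⟩
    simp only [hPa, sub_self, norm_zero] at this
    linarith
  obtain ⟨A, hA⟩ := hK.exists_bound_of_continuousOn
    (f := fun w : E × E => p w.1 + q w.2) (by fun_prop)
  -- The penalized value is at most that at (a, a), and p + q ≥ -A on the compact set.
  have hbound : ∀ n : ℕ, ‖Vᗮ.starProjection (w n).1‖ ^ 2 + ‖(w n).1 - (w n).2‖ ^ 2
      ≤ 2 * (p a + q a + A) / ((n : ℝ) + 1) := fun n => by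
    rw [le_div_iff₀ (by positivity)]
    have h1 := hA _ (hwK n)
    rw [Real.norm_eq_abs] at h1
    have h2 := (abs_le.1 h1).1
    have h3 := hle n
    have h4 := sq_nonneg ‖(w n).1 - a‖
    linarith
  have hzero : ‖Vᗮ.starProjection b‖ ^ 2 + ‖b - b'‖ ^ 2 ≤ 0 := by
    have l1 : Filter.Tendsto (fun n => ‖Vᗮ.starProjection (w (φ n)).1‖ ^ 2
        + ‖(w (φ n)).1 - (w (φ n)).2‖ ^ 2) Filter.atTop
        (nhds (‖Vᗮ.starProjection b‖ ^ 2 + ‖b - b'‖ ^ 2)) :=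
      ((((Vᗮ.starProjection.continuous.tendsto b).comp hx).norm).pow 2).add
        (((hx.sub hz).norm).pow 2)
    have l2 : Filter.Tendsto (fun n => 2 * (p a + q a + A) / ((φ n : ℝ) + 1)) Filter.atTop
        (nhds 0) :=
      ((tendsto_const_div_atTop_nhds_zero_nat (2 * (p a + q a + A))).comp
        ((Filter.tendsto_add_atTop_nat 1).comp hφ.tendsto_atTop)).congr fun n => by simp
    exact le_of_tendsto_of_tendsto' l1 l2 fun n => hbound (φ n)
  have hbb : b = b' := by
    have : ‖b - b'‖ ^ 2 = 0 := by nlinarith [sq_nonneg ‖Vᗮ.starProjection b‖, sq_nonneg ‖b - b'‖]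
    exact sub_eq_zero.1 (norm_eq_zero.1 (pow_eq_zero_iff two_ne_zero |>.1 this))
  have hbV : b ∈ V := by
    have : ‖Vᗮ.starProjection b‖ ^ 2 = 0 := by
      nlinarith [sq_nonneg ‖Vᗮ.starProjection b‖, sq_nonneg ‖b - b'‖]
    have := norm_eq_zero.1 (pow_eq_zero_iff two_ne_zero |>.1 this)
    rwa [Submodule.starProjection_apply_eq_zero_iff, Submodule.orthogonal_orthogonal] at this
  subst hbb
  -- The limit is feasible, so p + q is at least its value at a; the proximal term then forces b =
  -- a.
  have hba : b = a := by
    have l1 : Filter.Tendsto (fun n => p (w (φ n)).1 + q (w (φ n)).2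
        + 1 / 2 * ‖(w (φ n)).1 - a‖ ^ 2) Filter.atTop
        (nhds (p b + q b + 1 / 2 * ‖b - a‖ ^ 2)) :=
      (((hp.tendsto b).comp hx).add ((hq.tendsto b).comp hz)).add
        ((((hx.sub tendsto_const_nhds).norm).pow 2).const_mul _)
    have h1 : p b + q b + 1 / 2 * ‖b - a‖ ^ 2 ≤ p a + q a := le_of_tendsto' l1 fun n => by
      have : 0 ≤ ((φ n : ℝ) + 1) / 2 * (‖Vᗮ.starProjection (w (φ n)).1‖ ^ 2
        + ‖(w (φ n)).1 - (w (φ n)).2‖ ^ 2) := by positivity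
      linarith [hle (φ n)]
    have h2 := hmin b hb.1.1 hbV
    have : ‖b - a‖ ^ 2 = 0 := by nlinarith [sq_nonneg ‖b - a‖]
    exact sub_eq_zero.1 (norm_eq_zero.1 (pow_eq_zero_iff two_ne_zero |>.1 this))
  subst hba
  exact ⟨fun n => (φ n : ℝ) + 1, fun n => (w (φ n)).1, fun n => (w (φ n)).2,
    fun n => (hwK (φ n)).1.1, hx, hz, fun n => ⟨by positivity, fun x' hx' z' hz' =>
      isMinOn_iff.1 (hw (φ n)) (x', z') ⟨hx', hz'⟩⟩⟩

/-- First order optimality conditions for the minimization of the sum of a smooth and a convex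
function over the intersection of a closed set and a subspace, under the basic constraint
qualification. -/
theorem exists_optimality_of_isMin_inter_submodule (V : Submodule ℝ E) {C : Set E}
    (hC : IsClosed C) {p q : E → ℝ} (hp : ContDiff ℝ 1 p) (hq : ConvexOn ℝ Set.univ q) {a : E}
    (haC : a ∈ C) (haV : a ∈ V) (hmin : ∀ y ∈ C, y ∈ V → p a + q a ≤ p y + q y)
    (hCQ : ∀ w ∈ Vᗮ, w ∈ normalCone C a → w = 0) :
    ∃ s ∈ subdifferential q a, ∃ v ∈ normalCone C a, ∃ w ∈ Vᗮ,
      gradient p a + s + v + w = 0 := by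
  have hqc : Continuous q := continuousOn_univ.1 (hq.continuousOn isOpen_univ)
  have hgc : Continuous (gradient p) :=
    (InnerProductSpace.toDual ℝ E).symm.continuous.comp (hp.continuous_fderiv one_ne_zero)
  obtain ⟨c, x, z, hxC, hx, hz, hF⟩ :=
    exists_penalized_minimizers V hC hp.continuous hqc haC haV hmin
  set P := Vᗮ.starProjection with hP
  have hball : Metric.ball a 1 ∈ nhds a := Metric.ball_mem_nhds a one_pos
  -- From N on the minimizers lie in the open ball, so the ball constraint is inactive.
  obtain ⟨N, hN⟩ := Filter.eventually_atTop.1 ((hx.eventually hball).and (hz.eventually hball))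
  have hshift : Filter.Tendsto (fun n => n + N) Filter.atTop Filter.atTop :=
    Filter.tendsto_add_atTop_nat N
  have hs : ∀ n, c (n + N) • (x (n + N) - z (n + N)) ∈ subdifferential q (z (n + N)) := by
    intro n
    obtain ⟨hxb, hzb⟩ := hN (n + N) (Nat.le_add_left N n)
    refine mem_subdifferential_of_isLocalMin_add_sq hq ?_
    filter_upwards [Metric.isOpen_ball.mem_nhds hzb] with y hy
    have := (hF (n + N)).2 _ ⟨hxC _, Metric.ball_subset_closedBall hxb⟩ y
      (Metric.ball_subset_closedBall hy)
    linarith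
  have hv : ∀ n, -(gradient p (x (n + N)) + (c (n + N) • P (x (n + N))
      + c (n + N) • (x (n + N) - z (n + N)) + (x (n + N) - a)))
      ∈ regularNormalCone C (x (n + N)) := by
    intro n
    obtain ⟨hxb, hzb⟩ := hN (n + N) (Nat.le_add_left N n)
    generalize n + N = m at *
    -- The quadratic remainders are at most c/2 (as P is nonexpansive), c/2 and 1/2 times ‖e‖².
    refine neg_mem_regularNormalCone_of_le (c := c m + 1 / 2)
      (hp.differentiable one_ne_zero _).hasGradientAt ?_
    filter_upwards [self_mem_nhdsWithin,
      nhdsWithin_le_nhds (Metric.isOpen_ball.mem_nhds hxb)] with y hyC hy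
    have h := (hF m).2 y ⟨hyC, Metric.ball_subset_closedBall hy⟩ (z m)
      (Metric.ball_subset_closedBall hzb)
    obtain ⟨e, rfl⟩ : ∃ e, y = x m + e := ⟨y - x m, by abel⟩
    have e1 : ‖P (x m + e)‖ ^ 2 = ‖P (x m)‖ ^ 2 + 2 * inner ℝ (P (x m)) e + ‖P e‖ ^ 2 := by
      rw [map_add, norm_add_sq_real, hP, ← Submodule.inner_starProjection_left_eq_right,
        Submodule.starProjection_eq_self_iff.2 (Submodule.starProjection_apply_mem _ _)]
    have e2 : ‖x m + e - z m‖ ^ 2 = ‖x m - z m‖ ^ 2 + 2 * inner ℝ (x m - z m) e + ‖e‖ ^ 2 := by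
      rw [add_sub_right_comm, norm_add_sq_real]
    have e3 : ‖x m + e - a‖ ^ 2 = ‖x m - a‖ ^ 2 + 2 * inner ℝ (x m - a) e + ‖e‖ ^ 2 := by
      rw [add_sub_right_comm, norm_add_sq_real]
    have e4 : ‖P e‖ ^ 2 ≤ ‖e‖ ^ 2 :=
      pow_le_pow_left₀ (norm_nonneg _) (Submodule.norm_starProjection_apply_le _ _) 2
    have e5 := mul_le_mul_of_nonneg_left e4 (hF m).1.le
    rw [e1, e2, e3] at h
    rw [add_sub_cancel_left, inner_add_left, inner_add_left, real_inner_smul_left,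
      real_inner_smul_left]
    linarith
  have hx' := hx.comp hshift
  have hz' := hz.comp hshift
  obtain ⟨R, hR⟩ := exists_norm_le_of_mem_subdifferential hqc a
  obtain ⟨s, -, φ, hφ, hslim⟩ := tendsto_subseq_of_bounded
    (Metric.isBounded_closedBall (x := (0 : E)) (r := R))
    (x := fun n => c (n + N) • (x (n + N) - z (n + N))) fun n => by
      rw [mem_closedBall_zero_iff]
      exact hR _ (Metric.ball_subset_closedBall (hN (n + N) (Nat.le_add_left N n)).2) _ (hs n)
  have hxφ := hx'.comp hφ.tendsto_atTop
  have hzφ := hz'.comp hφ.tendsto_atTop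
  have hsa : s ∈ subdifferential q a :=
    mem_subdifferential_of_tendsto hqc (fun n => hs (φ n)) hzφ hslim
  obtain ⟨r, hr⟩ : ∃ r : ℕ → E, r = fun n => gradient p (x (φ n + N))
      + c (φ n + N) • (x (φ n + N) - z (φ n + N)) + (x (φ n + N) - a) := ⟨_, rfl⟩
  obtain ⟨w, hw⟩ : ∃ w : ℕ → E, w = fun n => c (φ n + N) • P (x (φ n + N)) := ⟨_, rfl⟩
  have hrlim : Filter.Tendsto r Filter.atTop (nhds (gradient p a + s)) := by
    have := (((hgc.tendsto a).comp hxφ).add hslim).add (hxφ.sub (tendsto_const_nhds (x := a)))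
    rw [sub_self, add_zero] at this
    rw [hr]
    exact this
  have hwV : ∀ n, w n ∈ Vᗮ := fun n => by
    rw [hw]
    exact Vᗮ.smul_mem _ (Submodule.starProjection_apply_mem _ _)
  have hVc : IsClosed (Vᗮ : Set E) := Submodule.isClosed_orthogonal V
  have hrw : ∀ n, -(r n + w n) ∈ regularNormalCone C (x (φ n + N)) := fun n => by
    convert hv (φ n) using 1
    simp only [hr, hw]
    abel
  by_cases hbd : ∃ R', ∃ᶠ n in Filter.atTop, ‖w n‖ ≤ R'
  · obtain ⟨R', hR'⟩ := hbd
    obtain ⟨w₀, -, ψ, hψ, hwlim⟩ := tendsto_subseq_of_frequently_bounded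
      (Metric.isBounded_closedBall (x := (0 : E)) (r := R')) (x := w)
      (hR'.mono fun n hn => by rwa [mem_closedBall_zero_iff])
    refine ⟨s, hsa, -(gradient p a + s + w₀), ⟨haC, fun n => x (φ (ψ n) + N),
      fun n => -(r (ψ n) + w (ψ n)), fun n => hxC _, fun n => hrw _,
      hxφ.comp hψ.tendsto_atTop, ?_⟩, w₀, ?_, by abel⟩
    · exact ((hrlim.comp hψ.tendsto_atTop).add hwlim).neg
    · exact hVc.mem_of_tendsto hwlim (Filter.Eventually.of_forall fun n => hwV _)
  · exfalso
    push Not at hbd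
    have hinf : Filter.Tendsto (fun n => ‖w n‖) Filter.atTop Filter.atTop :=
      Filter.tendsto_atTop.2 fun R' => (hbd R').mono fun n hn => hn.le
    obtain ⟨w₀, -, ψ, hψ, hwlim⟩ := tendsto_subseq_of_bounded
      (Metric.isBounded_closedBall (x := (0 : E)) (r := 1)) (x := fun n => (‖w n‖)⁻¹ • w n)
      fun n => by
        rw [mem_closedBall_zero_iff, norm_smul, norm_inv, norm_norm]
        exact inv_mul_le_one
    have hw0V : w₀ ∈ Vᗮ :=
      hVc.mem_of_tendsto hwlim (Filter.Eventually.of_forall fun n => Vᗮ.smul_mem _ (hwV _))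
    have hinfψ := hinf.comp hψ.tendsto_atTop
    have hnorm : ‖w₀‖ = 1 := by
      refine tendsto_nhds_unique hwlim.norm (tendsto_const_nhds.congr' ?_)
      filter_upwards [hinfψ.eventually_gt_atTop 0] with n hn
      simp only [Function.comp_apply] at hn ⊢
      rw [norm_smul, norm_inv, norm_norm, inv_mul_cancel₀ hn.ne']
    -- Dividing the regular normals by ‖w‖ → ∞ kills the convergent part `r`.
    have hmem : -w₀ ∈ normalCone C a := by
      refine ⟨haC, fun n => x (φ (ψ n) + N), fun n => (‖w (ψ n)‖)⁻¹ • -(r (ψ n) + w (ψ n)),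
        fun n => hxC _,
        fun n => smul_mem_regularNormalCone (hrw _) (inv_nonneg.2 (norm_nonneg _)),
        hxφ.comp hψ.tendsto_atTop, ?_⟩
      have := ((hinfψ.inv_tendsto_atTop.smul (hrlim.comp hψ.tendsto_atTop)).add hwlim).neg
      rw [zero_smul, zero_add] at this
      refine this.congr fun n => ?_
      simp [smul_add]
    have h0 := hCQ _ (Vᗮ.neg_mem hw0V) hmem
    rw [neg_eq_zero] at h0
    rw [h0, norm_zero] at hnorm
    exact zero_ne_one hnorm

end ConstrainedMinimizer


/-! ### Assembling normals and subgradients blockwise. -/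

section Products

variable {ι : Type*} [Fintype ι] {F : ι → Type*}
  [∀ i, NormedAddCommGroup (F i)] [∀ i, InnerProductSpace ℝ (F i)]

theorem PiLp.inner_toLp_update_sub [DecidableEq ι] (i : ι) (w x : PiLp 2 F) (b : F i) :
    inner ℝ w (WithLp.toLp 2 (Function.update (WithLp.ofLp x) i b) - x)
      = inner ℝ (w i) (b - x i) := by
  rw [PiLp.inner_apply, Finset.sum_eq_single i]
  · simp
  · intro j _ hj
    simp [Function.update_of_ne hj]
  · simp

theorem PiLp.norm_toLp_update_sub [DecidableEq ι] (i : ι) (x : PiLp 2 F) (b : F i) :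
    ‖WithLp.toLp 2 (Function.update (WithLp.ofLp x) i b) - x‖ = ‖b - x i‖ := by
  rw [← sq_eq_sq₀ (norm_nonneg _) (norm_nonneg _), ← real_inner_self_eq_norm_sq,
    PiLp.inner_toLp_update_sub, ← real_inner_self_eq_norm_sq]
  simp

/-- Blocks of regular normals to a product set at several points form a regular normal. -/
theorem toLp_diag_mem_regularNormalCone {A : ∀ i, Set (F i)} {z w : ι → PiLp 2 F}
    (hz : ∀ i j, z i j ∈ A j)
    (hw : ∀ i, w i ∈ regularNormalCone {x : PiLp 2 F | ∀ j, x j ∈ A j} (z i)) :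
    WithLp.toLp 2 (fun i => w i i) ∈
      regularNormalCone {x : PiLp 2 F | ∀ j, x j ∈ A j} (WithLp.toLp 2 (fun i => z i i)) := by
  classical
  intro ε hε
  have hδ : 0 < ε / (Fintype.card ι + 1) := by positivity
  have key : ∀ i, ∀ᶠ y in nhdsWithin (WithLp.toLp 2 (fun i => z i i) : PiLp 2 F)
      {x : PiLp 2 F | ∀ j, x j ∈ A j},
      inner ℝ (w i i) (y i - z i i) ≤ ε / (Fintype.card ι + 1) * ‖y i - z i i‖ := by
    intro i
    -- Replacing only block i of `z i` by that of y stays in the product set, so the inequality for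
    -- `w i` reduces to block i.
    have ht : Filter.Tendsto
        (fun y : PiLp 2 F => (WithLp.toLp 2 (Function.update (WithLp.ofLp (z i)) i (y i))
          : PiLp 2 F))
        (nhdsWithin (WithLp.toLp 2 (fun i => z i i)) {x : PiLp 2 F | ∀ j, x j ∈ A j})
        (nhdsWithin (z i) {x : PiLp 2 F | ∀ j, x j ∈ A j}) := by
      refine tendsto_nhdsWithin_iff.2 ⟨?_, ?_⟩
      · have hc : Continuous (fun y : PiLp 2 F =>
            (WithLp.toLp 2 (Function.update (WithLp.ofLp (z i)) i (y i)) : PiLp 2 F)) :=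
          (PiLp.continuous_toLp 2 F).comp
            (continuous_const.update i (PiLp.continuous_apply 2 F i))
        have := (hc.tendsto (WithLp.toLp 2 (fun i => z i i))).mono_left
          (nhdsWithin_le_nhds (s := {x : PiLp 2 F | ∀ j, x j ∈ A j}))
        convert this using 2
        simp
      · filter_upwards [self_mem_nhdsWithin] with y hy j
        rcases eq_or_ne j i with rfl | hj
        · simpa using hy j
        · simpa [Function.update_of_ne hj] using hz i j
    filter_upwards [ht.eventually (hw i _ hδ)] with y hy
    rwa [PiLp.inner_toLp_update_sub, PiLp.norm_toLp_update_sub] at hy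
  filter_upwards [Filter.eventually_all.2 key] with y hy
  rw [PiLp.inner_apply]
  calc ∑ i, inner ℝ (w i i) (y i - z i i)
      ≤ ∑ _i : ι, ε / (Fintype.card ι + 1) * ‖y - WithLp.toLp 2 (fun i => z i i)‖ := by
        refine Finset.sum_le_sum fun i _ => (hy i).trans ?_
        exact mul_le_mul_of_nonneg_left
          (PiLp.norm_apply_le (y - WithLp.toLp 2 (fun i => z i i)) i) hδ.le
    _ ≤ ε * ‖y - WithLp.toLp 2 (fun i => z i i)‖ := by
        rw [Finset.sum_const, Finset.card_univ, nsmul_eq_mul, ← mul_assoc]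
        refine mul_le_mul_of_nonneg_right ?_ (norm_nonneg _)
        rw [mul_div_left_comm]
        refine mul_le_of_le_one_right hε.le ?_
        rw [div_le_one (by positivity)]
        linarith

theorem toLp_diag_mem_normalCone {A : ∀ i, Set (F i)} {x : PiLp 2 F} {v : ι → PiLp 2 F}
    (hx : ∀ j, x j ∈ A j)
    (hv : ∀ i, v i ∈ normalCone {x : PiLp 2 F | ∀ j, x j ∈ A j} x) :
    WithLp.toLp 2 (fun i => v i i) ∈ normalCone {x : PiLp 2 F | ∀ j, x j ∈ A j} x := by
  choose _ z w hz hw hzl hwl using hv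
  refine ⟨hx, fun n => WithLp.toLp 2 (fun i => z i n i), fun n => WithLp.toLp 2 (fun i => w i n i),
    fun n j => hz j n j,
    fun n => toLp_diag_mem_regularNormalCone (fun i j => hz i n j) (fun i => hw i n), ?_, ?_⟩
  · exact ((PiLp.continuous_toLp 2 F).tendsto (fun i => x i)).comp
      (tendsto_pi_nhds.2 fun i => ((PiLp.continuous_apply 2 F i).tendsto x).comp (hzl i))
  · exact ((PiLp.continuous_toLp 2 F).tendsto (fun i => v i i)).comp
      (tendsto_pi_nhds.2 fun i => ((PiLp.continuous_apply 2 F i).tendsto (v i)).comp (hwl i))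

/-- Varying one block at a time cancels the other summands of q; the blockwise inequalities then add
up. -/
theorem toLp_diag_mem_subdifferential {h : ∀ i, F i → ℝ} {q : PiLp 2 F → ℝ}
    (hq : ∀ x, q x = ∑ i, h i (x i)) {x : PiLp 2 F} {s : ι → PiLp 2 F}
    (hs : ∀ i, s i ∈ subdifferential q x) :
    WithLp.toLp 2 (fun i => s i i) ∈ subdifferential q x := by
  classical
  intro y
  have key : ∀ i, h i (x i) + inner ℝ (s i i) (y i - x i) ≤ h i (y i) := by
    intro i
    have := hs i (WithLp.toLp 2 (Function.update (WithLp.ofLp x) i (y i)))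
    rw [PiLp.inner_toLp_update_sub, hq, hq, ← Finset.add_sum_erase _ _ (Finset.mem_univ i),
      ← Finset.add_sum_erase _ _ (Finset.mem_univ i)] at this
    have e : ∑ j ∈ Finset.univ.erase i,
        h j ((WithLp.toLp 2 (Function.update (WithLp.ofLp x) i (y i)) : PiLp 2 F) j)
        = ∑ j ∈ Finset.univ.erase i, h j (x j) :=
      Finset.sum_congr rfl fun j hj => by simp [Function.update_of_ne (Finset.ne_of_mem_erase hj)]
    rw [e] at this
    simp only [Function.update_self] at this
    linarith
  rw [hq, hq, PiLp.inner_apply, ← Finset.sum_add_distrib]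
  exact Finset.sum_le_sum fun i _ => key i

end Products

/-! ### Local problems as restrictions of the global one. -/

namespace NSDASF

section LocalProblem

variable {K Q D : ℕ} {L M : Fin K → ℕ} {T : Type*}

/-- This transposition identity makes the local objective and constraints the global ones composed
with `expand`. -/
theorem blk_expand_transpose_mul {n : Type*} (q : Fin K) (X : BlockSpace (fun k => Fin (M k)) Q)
    (Z : BlockSpace (LocalRow M Q q) Q) (k : Fin K) (A : Matrix (Fin (M k)) n ℝ) :
    (blk (expand q X Z) k).transpose * A = (blk Z k).transpose * compress q X k A := by
  by_cases h : k = q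
  · have : IsEmpty {_j : Fin Q // k ≠ q} := ⟨fun j => j.2 h⟩
    ext a t
    simp only [Matrix.mul_apply, Fintype.sum_sum_type, Finset.univ_eq_empty, Finset.sum_empty,
      add_zero]
    refine Fintype.sum_equiv (Equiv.subtypeUnivEquiv fun _ => h).symm _ _ fun i => ?_
    simp [compress, expand, stack, blk, mat, vec, h]
  · have : IsEmpty {_i : Fin (M k) // k = q} := ⟨fun j => h j.2⟩
    have e : blk (expand q X Z) k
        = blk X k * Matrix.of (fun j => blk Z k (Sum.inr ⟨j, h⟩)) := by
      ext i j
      simp [expand, stack, blk, mat, vec, h]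
    rw [e, Matrix.transpose_mul, Matrix.mul_assoc]
    ext a t
    rw [Matrix.mul_apply, Matrix.mul_apply]
    simp only [Fintype.sum_sum_type, Finset.univ_eq_empty, Finset.sum_empty, zero_add]
    refine Fintype.sum_equiv (Equiv.subtypeUnivEquiv fun _ => h).symm _ _ fun i => ?_
    simp [compress]

variable (S : Spec K Q D L T) (d : Data D L T (fun k => Fin (M k)))

theorem smoothPart_localData (q : Fin K) (X : BlockSpace (fun k => Fin (M k)) Q)
    (Z : BlockSpace (LocalRow M Q q) Q) :
    smoothPart S (localData d q X) Z = smoothPart S d (expand q X Z) := by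
  simp only [smoothPart, localData, blk_expand_transpose_mul]

theorem nonsmoothPart_localData (q : Fin K) (X : BlockSpace (fun k => Fin (M k)) Q)
    (Z : BlockSpace (LocalRow M Q q) Q) :
    nonsmoothPart S (localData d q X) Z = nonsmoothPart S d (expand q X Z) := by
  simp only [nonsmoothPart, localData, blk_expand_transpose_mul]

theorem mem_feasibleSet_localData (q : Fin K) (X : BlockSpace (fun k => Fin (M k)) Q)
    (Z : BlockSpace (LocalRow M Q q) Q) :
    Z ∈ feasibleSet S (localData d q X) ↔ expand q X Z ∈ feasibleSet S d := by
  simp only [feasibleSet, localData, blk_expand_transpose_mul, Set.mem_ofPred_eq]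

/-- The subspace constraints of node `q` as a linear subspace. -/
def subspaceConstrSubmodule (q : Fin K) (X : BlockSpace (fun k => Fin (M k)) Q) :
    Submodule ℝ (BlockSpace (fun k => Fin (M k)) Q) where
  carrier := subspaceConstr q X
  add_mem' hY hZ k hk j := Submodule.add_mem _ (hY k hk j) (hZ k hk j)
  zero_mem' _ _ _ := Submodule.zero_mem _
  smul_mem' c _ hZ k hk j := Submodule.smul_mem _ c (hZ k hk j)

theorem self_mem_subspaceConstr (q : Fin K) (X : BlockSpace (fun k => Fin (M k)) Q) :
    X ∈ subspaceConstr q X :=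
  fun _ _ j => Submodule.subset_span ⟨j, rfl⟩

theorem exists_expand_eq {q : Fin K} {X Z : BlockSpace (fun k => Fin (M k)) Q}
    (hZ : Z ∈ subspaceConstr q X) : ∃ Zbar, expand q X Zbar = Z := by
  have hG : ∀ k, k ≠ q → ∀ j, ∃ c : Fin Q → ℝ, ∑ i, c i • (blk X k).col i = (blk Z k).col j :=
    fun k hk j => (Submodule.mem_span_range_iff_exists_fun ℝ).1 (hZ k hk j)
  choose G hG using hG
  refine ⟨stack fun k => Matrix.of
    (Sum.elim (fun i => blk Z k i.1) (fun j b => G k j.2 b j.1)), ?_⟩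
  ext k ⟨i, j⟩
  by_cases h : k = q
  · simp [expand, stack, blk, mat, vec, h]
  · have := congrFun (hG k h j) i
    simp only [Finset.sum_apply, Pi.smul_apply, smul_eq_mul, Matrix.col_apply] at this
    simp only [expand, stack, h, vec, dif_neg, not_false_eq_true]
    rw [Matrix.mul_apply]
    refine Eq.trans (Finset.sum_congr rfl fun b _ => ?_) this
    simp only [blk, mat, Matrix.of_apply, Sum.elim_inr]
    exact mul_comm _ _

/-- Block q is free: test w against the vector with block q equal to `w q` and zeros elsewhere. -/
theorem apply_eq_zero_of_mem_orthogonal {q : Fin K} {X w : BlockSpace (fun k => Fin (M k)) Q}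
    (hw : w ∈ (subspaceConstrSubmodule q X)ᗮ) : w q = 0 := by
  have hmem : WithLp.toLp 2 (Function.update (WithLp.ofLp
      (0 : BlockSpace (fun k => Fin (M k)) Q)) q (w q)) ∈ subspaceConstrSubmodule q X := by
    intro k hk j
    convert Submodule.zero_mem _ using 1
    ext i
    simp [blk, mat, Function.update_of_ne hk]
  have h := Submodule.inner_left_of_mem_orthogonal hmem hw
  have e := PiLp.inner_toLp_update_sub q w (0 : BlockSpace (fun k => Fin (M k)) Q) (w q)
  rw [sub_zero, h] at e
  simpa using e.symm

variable {S d}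

theorem IsFixedPoint.isUpdate [NeZero K] {X : BlockSpace (fun k => Fin (M k)) Q}
    (hX : IsFixedPoint S d X) (q : Fin K) : IsUpdate S d q X X X := by
  obtain ⟨⟨Y, hY, h0⟩, huniq⟩ := hX
  have hconst := huniq Y hY h0
  -- Iteration number q updates node q because q < K; at q = 0 truncated subtraction gives the
  -- previous iterate `Y 0`.
  have h := hY q
  rw [hconst, hconst, hconst] at h
  convert h
  simp [Fin.ofNat, Nat.mod_eq_of_lt q.2]

theorem IsUpdate.mem_feasibleSet {q : Fin K} {Y X Z : BlockSpace (fun k => Fin (M k)) Q}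
    (h : IsUpdate S d q Y X Z) : Z ∈ feasibleSet S d := by
  obtain ⟨Zbar, hsol, -, rfl⟩ := h
  exact (mem_feasibleSet_localData S d q X Zbar).1 hsol.1

theorem IsUpdate.le {q : Fin K} {Y X Z : BlockSpace (fun k => Fin (M k)) Q}
    (h : IsUpdate S d q Y X Z) {W : BlockSpace (fun k => Fin (M k)) Q}
    (hW : W ∈ feasibleSet S d) (hWX : W ∈ subspaceConstr q X) :
    smoothPart S d Z + nonsmoothPart S d Z ≤ smoothPart S d W + nonsmoothPart S d W := by
  obtain ⟨Zbar, hsol, -, rfl⟩ := h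
  obtain ⟨Wbar, rfl⟩ := exists_expand_eq hWX
  have := hsol.2 Wbar ((mem_feasibleSet_localData S d q X Wbar).2 hW)
  simpa only [smoothPart_localData, nonsmoothPart_localData] using this

end LocalProblem

end NSDASF

/-! ### Stationarity of fixed points. -/

theorem theorem1 {K Q D : ℕ} [NeZero K] {M L : Fin K → ℕ} {T : Type*}
    (S : NSDASF.Spec K Q D L T) (d : NSDASF.Data D L T (fun k => Fin (M k)))
    -- the smooth term is continuously differentiable, with compact sublevel sets
    (hp : ContDiff ℝ 1 (NSDASF.smoothPart S d))
    (hp_compact : ∀ c : ℝ, IsCompact {X | NSDASF.smoothPart S d X ≤ c})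
    -- the nonsmooth term is convex and separable over the blocks
    (hq : ConvexOn ℝ Set.univ (NSDASF.nonsmoothPart S d))
    (g : ∀ k : Fin K, Matrix (Fin Q) (Fin (L k)) ℝ → ℝ)
    (hg : ∀ X, NSDASF.nonsmoothPart S d X =
      ∑ k, g k ((NSDASF.blk X k).transpose * d.Γ k))
    -- the feasible set is closed
    (hD : IsClosed (NSDASF.feasibleSet S d))
    (Xs : NSDASF.BlockSpace (fun k => Fin (M k)) Q)
    (hXs : NSDASF.IsFixedPoint S d Xs)
    -- the constraint qualification
    (hCQ : ∀ k : Fin K,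
      normalCone (NSDASF.feasibleSet S d) Xs ∩
        normalCone (NSDASF.subspaceConstr k Xs) Xs = {0}) :
    Xs ∈ NSDASF.feasibleSet S d ∧
      (0 : NSDASF.BlockSpace (fun k => Fin (M k)) Q) ∈
        ({gradient (NSDASF.smoothPart S d) Xs} : Set _)
          + subdifferential (NSDASF.nonsmoothPart S d) Xs
          + normalCone (NSDASF.feasibleSet S d) Xs := by

  have hfeas : Xs ∈ NSDASF.feasibleSet S d := (hXs.isUpdate 0).mem_feasibleSet
  have hopt : ∀ k, ∃ s ∈ subdifferential (NSDASF.nonsmoothPart S d) Xs,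
      ∃ v ∈ normalCone (NSDASF.feasibleSet S d) Xs,
      ∃ w ∈ (NSDASF.subspaceConstrSubmodule k Xs)ᗮ,
        gradient (NSDASF.smoothPart S d) Xs + s + v + w = 0 := fun k =>
    exists_optimality_of_isMin_inter_submodule (NSDASF.subspaceConstrSubmodule k Xs) hD hp hq
      hfeas (NSDASF.self_mem_subspaceConstr k Xs)
      (fun y hy hyV => (hXs.isUpdate k).le hy hyV)
      (fun w hw hwD => by
        have h : w ∈ normalCone (NSDASF.feasibleSet S d) Xs ∩
            normalCone (NSDASF.subspaceConstr k Xs) Xs :=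
          ⟨hwD, orthogonal_subset_normalCone (NSDASF.subspaceConstrSubmodule k Xs)
            (NSDASF.self_mem_subspaceConstr k Xs) hw⟩
        rwa [hCQ k] at h)
  choose s hs v hv w hw hsum using hopt
  have hv' := toLp_diag_mem_normalCone
    (A := fun k => {x | ((NSDASF.mat x).transpose * d.y k, (NSDASF.mat x).transpose * d.B k)
      ∈ S.constr k}) hfeas hv
  have hs' := toLp_diag_mem_subdifferential
    (h := fun k x => g k ((NSDASF.mat x).transpose * d.Γ k)) hg hs
  refine ⟨hfeas, Set.mem_add.2 ⟨_, Set.add_mem_add rfl hs', _, hv', ?_⟩⟩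
  -- Block k of the claim is block k of the identity for node k, where `w k` vanishes.
  ext1 k
  have := congrArg (fun X => X k) (hsum k)
  simpa [NSDASF.apply_eq_zero_of_mem_orthogonal (hw k)] using this
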